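/- Definitions. A circle on the Riemann sphere always comes with its interior, one of the two open discs that it bounds. Two circles are tangent if they meet in exactly one point and their interiors are disjoint. For $n>3$, a (closed) $n$-flower consists of a central circle $C$ and petals $c_0,\dots,c_{n-1}$ (indices mod $n$), each tangent to $C$, with $c_j$ tangent to $c_{j+1}$ for all $j$. Its petals wrap $k$ times around $C$ if the successive points of tangency $C\cap c_0, C\cap c_1,\dots,C\cap c_{n-1}, C\cap c_0$, each step moving counterclockwise along $C$ (with respect to the interior of $C$) by less than a full turn, make $k$ full turns in total. The flower is un-branched if its petals wrap exactly once; petals that are not neighbours may be tangent or overlap. The base patch consists of the circles $C_v,C_w,C_a,C_b$ of radius $\sqrt3$ with centers $1-i\sqrt3,\ 1+i\sqrt3,\ -2,\ 4$ (and the bounded discs as interiors). A patch $\{v,w\mid a,b\}$ has (intrinsic) schwarzian $s\in\mathbb R$ if, for the Möbius transformations $m_f$ taking $(C_v,C_w,C_a)$ to $(v,w,a)$ and $m_g$ taking $(C_v,C_w,C_b)$ to $(v,w,b)$, the transformation $m_g^{-1}\circ m_f$ is represented by the matrix $\begin{pmatrix}1+s&-s\\ s&1-s\end{pmatrix}$.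 A packing label for an un-branched $n$-flower is a sequence $(s_0,\dots,s_{n-1})$, or equivalently $(u_0,\dots,u_{n-1})$ with $u_j=1-s_j$, such that there is an un-branched $n$-flower in which for every $j$ the patch $\{c_j,C\mid c_{j-1},c_{j+1}\}$ has schwarzian $s_j$. Define polynomials $\mathcal C_j(x_1,\dots,x_{j-1})$ by $\mathcal C_0=0$, $\mathcal C_1=1$ and $\mathcal C_{j+1}=\sqrt3\,x_j\,\mathcal C_j-\mathcal C_{j-1}$ for $j\ge1$ (so $\mathcal C_2=\sqrt3\,x_1$, $\mathcal C_3=3x_1x_2-1$), and rational functions $\mathcal U_n(x_1,\dots,x_{n-3})=\dfrac{1+\mathcal C_{n-3}(x_1,\dots,x_{n-4})}{\sqrt3\,\mathcal C_{n-2}(x_1,\dots,x_{n-3})}$ for $n>3$. Theorem. Let $n>3$ and let $u_1,\dots,u_{n-3}$ be real numbers. They are part of a packing label $(u_0,\dots,u_{n-1})$ for an un-branched $n$-flower if and only if $$\mathcal C_j(u_1,\dots,u_{j-1})>0\qquad\text{for } j=2,\dots,n-2.$$ In this case, the remaining three entries of every such packing label are $$u_{n-2}=\mathcal U_n(u_1,\dots,u_{n-3}),\qquad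 u_{n-1}=\mathcal U_n(u_2,\dots,u_{n-2}),\qquad u_0=\mathcal U_n(u_3,\dots,u_{n-1}),$$ where the denominators of these three expressions do not vanish. -/

import Mathlib

noncomputable section

namespace FlowerPacking

/-- The Riemann sphere, as the one-point compactification of the plane. Moebius transformations are
given by invertible complex matrices through Mathlib's action of `GL (Fin 2) ℂ`, which sends `z` to
`(a z + b) / (c z + d)`. -/
abbrev Sphere : Type := OnePoint ℂ

/-- The matrix of the Moebius transformation `z ↦ r z + z₀`, for `r ≠ 0`. -/
def affineMatrix (z₀ : ℂ) (r : ℂ) (hr : r ≠ 0) : GL (Fin 2) ℂ :=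
  Matrix.GeneralLinearGroup.mkOfDetNeZero !![r, z₀; 0, 1] (by simpa [Matrix.det_fin_two] using hr)

theorem affineMatrix_smul (z₀ r : ℂ) (hr : r ≠ 0) (z : ℂ) :
    affineMatrix z₀ r hr • (z : Sphere) = ((r * z + z₀ : ℂ) : Sphere) := by
  rw [OnePoint.smul_some_eq_ite]
  simp [affineMatrix, Matrix.GeneralLinearGroup.mkOfDetNeZero]

/-- The Euclidean circle with center `z₀` and radius `r`, as a subset of the sphere. -/
def euclidBdry (z₀ : ℂ) (r : ℝ) : Set Sphere := (fun z : ℂ => (z : Sphere)) '' Metric.sphere z₀ r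

/-- The open Euclidean disc with center `z₀` and radius `r`, as a subset of the sphere. -/
def euclidInner (z₀ : ℂ) (r : ℝ) : Set Sphere := (fun z : ℂ => (z : Sphere)) '' Metric.ball z₀ r

/-- The image of a subset of the sphere under a Moebius transformation. -/
def mobiusImage (m : GL (Fin 2) ℂ) (S : Set Sphere) : Set Sphere := (fun p : Sphere => m • p) '' S

theorem mobiusImage_mul (m m' : GL (Fin 2) ℂ) (S : Set Sphere) :
    mobiusImage (m * m') S = mobiusImage m (mobiusImage m' S) := by
  simp [mobiusImage, Set.image_image, mul_smul]

theorem affine_image (z₀ : ℂ) (r : ℝ) (hr : 0 < r) (S T : Set ℂ)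
    (h : ∀ z : ℂ, (r : ℂ) * z + z₀ ∈ T ↔ z ∈ S) :
    (fun z : ℂ => (z : Sphere)) '' T =
      mobiusImage (affineMatrix z₀ r (by exact_mod_cast hr.ne'))
        ((fun z : ℂ => (z : Sphere)) '' S) := by
  have hr' : (r : ℂ) ≠ 0 := by exact_mod_cast hr.ne'
  ext p
  constructor
  · rintro ⟨w, hw, rfl⟩
    refine ⟨_, ⟨(w - z₀) / r, (h _).1 ?_, rfl⟩, ?_⟩
    · rwa [mul_div_cancel₀ _ hr', sub_add_cancel]
    · simp only [affineMatrix_smul]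
      rw [mul_div_cancel₀ _ hr', sub_add_cancel]
  · rintro ⟨_, ⟨z, hz, rfl⟩, rfl⟩
    exact ⟨r * z + z₀, (h z).2 hz, (affineMatrix_smul _ _ hr' z).symm⟩

/-- A circle on the Riemann sphere together with its interior (one of the two open discs that it
bounds): the image of the unit circle and the open unit disc under a Moebius transformation. Lines
with a half plane as interior, and circles with `∞` in the interior, are included. -/
@[ext]
structure SCircle where
  /-- the points of the circle -/
  bdry : Set Sphere
  /-- the interior of the circle -/
  inner : Set Sphere
  exists_mobius : ∃ m : GL (Fin 2) ℂ,
    bdry = mobiusImage m (euclidBdry 0 1) ∧ inner = mobiusImage m (euclidInner 0 1)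

/-- The image of a circle with interior under a Moebius transformation. -/
def SCircle.map (m : GL (Fin 2) ℂ) (c : SCircle) : SCircle where
  bdry := mobiusImage m c.bdry
  inner := mobiusImage m c.inner
  exists_mobius := by
    obtain ⟨m', h₁, h₂⟩ := c.exists_mobius
    exact ⟨m * m', by rw [h₁, mobiusImage_mul], by rw [h₂, mobiusImage_mul]⟩

/-- The Euclidean circle with center `z₀` and radius `r > 0`, with the bounded disc as interior. -/
def SCircle.euclid (z₀ : ℂ) (r : ℝ) (hr : 0 < r) : SCircle where
  bdry := euclidBdry z₀ r
  inner := euclidInner z₀ r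
  exists_mobius :=
    ⟨affineMatrix z₀ r (by exact_mod_cast hr.ne'),
      affine_image z₀ r hr _ _ fun z => by
        simp [abs_of_pos hr, hr.ne'],
      affine_image z₀ r hr _ _ fun z => by
        simp [abs_of_pos hr, hr]⟩

/-- Two circles are (externally) tangent if they meet in a single point and their interiors are
disjoint. -/
def SCircle.Tangent (c d : SCircle) : Prop :=
  (∃ p : Sphere, c.bdry ∩ d.bdry = {p}) ∧ Disjoint c.inner d.inner

theorem sqrt_three_pos : (0 : ℝ) < √3 := Real.sqrt_pos.2 (by norm_num)

/-- The base patch: four circles of radius `√3`. The face `f` is formed by `baseV`, `baseW`, `baseA`,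
and the face `g` by `baseW`, `baseV`, `baseB`. The centers form two equilateral triangles, and the
common edge runs vertically upwards through the point `1`, from `baseV` to `baseW`. -/
def baseV : SCircle := SCircle.euclid ⟨1, -√3⟩ (√3) sqrt_three_pos

/-- The upper circle of the common edge of the base patch. -/
def baseW : SCircle := SCircle.euclid ⟨1, √3⟩ (√3) sqrt_three_pos

/-- The third circle of the face `f` of the base patch. -/
def baseA : SCircle := SCircle.euclid (-2) (√3) sqrt_three_pos

/-- The third circle of the face `g` of the base patch. -/
def baseB : SCircle := SCircle.euclid 4 (√3) sqrt_three_pos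

/-- The matrix `M_s = I + s • [1, -1; 1, -1]`. -/
def edgeMatrix (s : ℝ) : Matrix (Fin 2) (Fin 2) ℂ := !![1 + (s : ℂ), -(s : ℂ); (s : ℂ), 1 - (s : ℂ)]

/-- The patch `{v, w | a, b}` has intrinsic schwarzian `s`: for the face maps `m_f`, `m_g`, that is,
the Moebius transformations that take the two faces of the base patch to the faces `{v, w, a}` and
`{w, v, b}`, the Moebius transformation `m_g⁻¹ ∘ m_f` is represented by `M_s`. -/
def HasSchwarzian (v w a b : SCircle) (s : ℝ) : Prop :=
  ∃ mf mg : GL (Fin 2) ℂ,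
    (baseV.map mf = v ∧ baseW.map mf = w ∧ baseA.map mf = a) ∧
    (baseV.map mg = v ∧ baseW.map mg = w ∧ baseB.map mg = b) ∧
    ∃ k : ℂ, k ≠ 0 ∧ ((mg⁻¹ * mf : GL (Fin 2) ℂ) : Matrix (Fin 2) (Fin 2) ℂ) = k • edgeMatrix s

/-- `{C; c_0, …, c_{n-1}}` is a closed `n`-flower with center `C`: every petal is tangent to `C`, and
cyclically successive petals are tangent. -/
def IsFlower {n : ℕ} (C : SCircle) (c : ZMod n → SCircle) : Prop :=
  (∀ j, C.Tangent (c j)) ∧ ∀ j, (c j).Tangent (c (j + 1))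

/-- The petals `c_0, c_1, …, c_{n-1}, c_n = c_0` wrap `k` times around `C`: in an angular coordinate
`θ` on the circle `C`, transported by a Moebius transformation from the unit circle with the unit
disc as its interior, the successive points of tangency with `C` advance counterclockwise, each
step by less than a full turn, and by `k` full turns in total. -/
def Wraps {n : ℕ} (C : SCircle) (c : ZMod n → SCircle) (k : ℕ) : Prop :=
  ∃ (m : GL (Fin 2) ℂ) (θ : ℕ → ℝ),
    (SCircle.euclid 0 1 one_pos).map m = C ∧
    (∀ j ≤ n, m • ((Complex.exp (θ j * Complex.I) : ℂ) : Sphere) ∈ C.bdry ∩ (c (j : ZMod n)).bdry) ∧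
    (∀ j < n, θ j < θ (j + 1) ∧ θ (j + 1) < θ j + 2 * Real.pi) ∧
    θ n = θ 0 + 2 * Real.pi * k

/-- A flower is un-branched if its petals wrap once around the center. -/
def IsUnbranchedFlower {n : ℕ} (C : SCircle) (c : ZMod n → SCircle) : Prop :=
  IsFlower C c ∧ Wraps C c 1

/-- `s_0, …, s_{n-1}` is a packing label for an un-branched `n`-flower: there is such a flower in
which, for each `j`, the patch `{c_j, C | c_{j-1}, c_{j+1}}` has schwarzian `s_j`. -/
def IsUnbranchedLabel (n : ℕ) (s : ZMod n → ℝ) : Prop :=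
  ∃ (C : SCircle) (c : ZMod n → SCircle), IsUnbranchedFlower C c ∧
    ∀ j, HasSchwarzian (c j) C (c (j - 1)) (c (j + 1)) (s j)

/-- The polynomials `𝒞_j(x_1, …, x_{j-1})`; of the sequence `x` only these entries are used. -/
def cPoly : ℕ → (ℕ → ℝ) → ℝ
  | 0, _ => 0
  | 1, _ => 1
  | j + 2, x => √3 * x (j + 1) * cPoly (j + 1) x - cPoly j x

/-- The rational functions `𝒰_n(x_1, …, x_{n-3})`. -/
def uFun (n : ℕ) (x : ℕ → ℝ) : ℝ := (1 + cPoly (n - 3) x) / (√3 * cPoly (n - 2) x)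

end FlowerPacking

end

/-! Normalise the center to be the real line with the lower half plane as interior. A petal is then
a horodisc, given by a real vector (p, q) up to sign: it touches the line at p/q and has diameter
1/q². In these coordinates the base patch is the line with the vectors (1, 0), (0, 1), (√3, 1), and
the edge matrix `M_s` becomes the translation by √3 s. Hence the vectors e_j of the petals, with
suitable signs, satisfy e_{j+1} = √3 u_j e_j - e_{j-1} and det(e_j, e_{j+1}) = 1
(`exists_faceMaps`), and the determinants det(e_i, e_{i+j}) are the continuants 𝒞_j of u_{i+1},
u_{i+2}, … (`cPoly_eq_wedge`).

A full turn of the tangency points is a half turn of the vectors. So the flower is un-branched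
exactly when the frames close up to -1 and the vectors turn counterclockwise by π in total. Then
det(e_i, e_j) > 0 for 0 ≤ i < j ≤ n except for the pair (0, n) (`wedge_pos_of_wraps`), which
contains the inequalities. Since e_{n+i} = -e_i, also det(e_i, e_{i+n-1}) = 1; solving the recursion
there for its last coefficient gives the formula 𝒰_n (`eq_uFun_of_closed`).

Conversely, given the inequalities, three free coefficients suffice to close the frames up to -1
(`exists_closed_frames`), and the horodiscs of the resulting vectors form the flower
(`isUnbranchedLabel_of_frames`). -/

noncomputable section

namespace FlowerPacking

/-! ### Homogeneous coordinates on the sphere. -/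

/-- The point of the sphere with homogeneous coordinates `[z : w]`. -/
def homog (z w : ℂ) : Sphere := if w = 0 then OnePoint.infty else ((z / w : ℂ) : Sphere)

theorem homog_one (z : ℂ) : homog z 1 = (z : Sphere) := by simp [homog]

theorem homog_zero {z : ℂ} : homog z 0 = OnePoint.infty := by simp [homog]

theorem exists_homog (p : Sphere) : ∃ z w : ℂ, (z ≠ 0 ∨ w ≠ 0) ∧ homog z w = p := by
  induction p using OnePoint.rec with
  | infty => exact ⟨1, 0, by simp, homog_zero⟩
  | coe z => exact ⟨z, 1, by simp, homog_one z⟩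

theorem homog_eq_homog_iff {z w z' w' : ℂ} (h : z ≠ 0 ∨ w ≠ 0) (h' : z' ≠ 0 ∨ w' ≠ 0) :
    homog z w = homog z' w' ↔ z * w' = z' * w := by
  unfold homog
  by_cases hw : w = 0 <;> by_cases hw' : w' = 0
  · simp [hw, hw']
  · have hz : z ≠ 0 := by simpa [hw] using h
    simp [hw, hw', hz]
  · have hz : z' ≠ 0 := by simpa [hw'] using h'
    simp [hw, hw', hz]
  · simp only [hw, hw', if_false, OnePoint.coe_eq_coe]
    rw [div_eq_div_iff hw hw']

theorem mulVec_ne_zero (m : GL (Fin 2) ℂ) {z w : ℂ} (h : z ≠ 0 ∨ w ≠ 0) :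
    m 0 0 * z + m 0 1 * w ≠ 0 ∨ m 1 0 * z + m 1 1 * w ≠ 0 := by
  by_contra! hc
  obtain ⟨h₁, h₂⟩ := hc
  have hd := m.det_ne_zero
  rw [Matrix.det_fin_two] at hd
  have hz : z = 0 := (mul_eq_zero.1 (show (m 0 0 * m 1 1 - m 0 1 * m 1 0) * z = 0 by
    linear_combination m 1 1 * h₁ - m 0 1 * h₂)).resolve_left hd
  have hw : w = 0 := (mul_eq_zero.1 (show (m 0 0 * m 1 1 - m 0 1 * m 1 0) * w = 0 by
    linear_combination m 0 0 * h₂ - m 1 0 * h₁)).resolve_left hd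
  simp [hz, hw] at h

theorem smul_homog (m : GL (Fin 2) ℂ) {z w : ℂ} (h : z ≠ 0 ∨ w ≠ 0) :
    m • homog z w = homog (m 0 0 * z + m 0 1 * w) (m 1 0 * z + m 1 1 * w) := by
  by_cases hw : w = 0
  · have hz : z ≠ 0 := by simpa [hw] using h
    simp only [hw, homog_zero, OnePoint.smul_infty_eq_ite, mul_zero, add_zero]
    by_cases hc : m 1 0 = 0
    · simp [hc, homog]
    · simp only [hc, if_false, homog, mul_eq_zero, hz, or_self]
      rw [mul_div_mul_right _ _ hz]
  · have e : ∀ a b : ℂ, a * (z / w) + b = (a * z + b * w) / w := fun a b => by field_simp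
    rw [homog, if_neg hw, OnePoint.smul_some_eq_ite, e, e]
    by_cases hc : m 1 0 * z + m 1 1 * w = 0
    · simp [hc, homog]
    · rw [if_neg (div_ne_zero hc hw), div_div_div_cancel_right₀ hw, homog, if_neg hc]

theorem mem_mobiusImage_iff (m : GL (Fin 2) ℂ) (S : Set Sphere) (p : Sphere) :
    p ∈ mobiusImage m S ↔ m⁻¹ • p ∈ S := by
  constructor
  · rintro ⟨q, hq, rfl⟩
    simpa using hq
  · exact fun h => ⟨_, h, by simp⟩

theorem smul_mem_mobiusImage_iff (m : GL (Fin 2) ℂ) (S : Set Sphere) (p : Sphere) :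
    m • p ∈ mobiusImage m S ↔ p ∈ S := by
  rw [mem_mobiusImage_iff, inv_smul_smul]

/-! ### Circles with interior as signs of Hermitian forms. -/

/-- The points of the circle and of its interior are the zeros and the negative points of `Q`, in
homogeneous coordinates. -/
structure HasForm (c : SCircle) (Q : ℂ → ℂ → ℝ) : Prop where
  bdry : ∀ z w : ℂ, (z ≠ 0 ∨ w ≠ 0) → (homog z w ∈ c.bdry ↔ Q z w = 0)
  inner : ∀ z w : ℂ, (z ≠ 0 ∨ w ≠ 0) → (homog z w ∈ c.inner ↔ Q z w < 0)

theorem HasForm.ext {c d : SCircle} {Q : ℂ → ℂ → ℝ} (hc : HasForm c Q) (hd : HasForm d Q) :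
    c = d := by
  apply SCircle.ext
  · ext p
    obtain ⟨z, w, h, rfl⟩ := exists_homog p
    rw [hc.bdry z w h, hd.bdry z w h]
  · ext p
    obtain ⟨z, w, h, rfl⟩ := exists_homog p
    rw [hc.inner z w h, hd.inner z w h]

theorem HasForm.map {c : SCircle} {Q Q' : ℂ → ℂ → ℝ} (hc : HasForm c Q) (m : GL (Fin 2) ℂ)
    {κ : ℝ} (hκ : 0 < κ)
    (h : ∀ z w, Q' (m 0 0 * z + m 0 1 * w) (m 1 0 * z + m 1 1 * w) = κ * Q z w) :
    HasForm (c.map m) Q' := by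
  have key : ∀ z w : ℂ, (z ≠ 0 ∨ w ≠ 0) → ∃ z' w' : ℂ, (z' ≠ 0 ∨ w' ≠ 0) ∧
      m⁻¹ • homog z w = homog z' w' ∧ Q' z w = κ * Q z' w' := by
    intro z w hzw
    refine ⟨_, _, mulVec_ne_zero m⁻¹ hzw, smul_homog _ hzw, ?_⟩
    rw [← h]
    have e : ∀ i j : Fin 2, m i 0 * m⁻¹ 0 j + m i 1 * m⁻¹ 1 j = if i = j then 1 else 0 := by
      intro i j
      have := congrArg (fun g : GL (Fin 2) ℂ => (g : Matrix (Fin 2) (Fin 2) ℂ) i j)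
        (mul_inv_cancel m)
      simp only [Matrix.GeneralLinearGroup.coe_mul, Matrix.GeneralLinearGroup.coe_one,
        Matrix.mul_apply, Fin.sum_univ_two, Matrix.one_apply] at this
      exact this
    have e00 := e 0 0
    have e01 := e 0 1
    have e10 := e 1 0
    have e11 := e 1 1
    simp only [if_true, Fin.isValue, zero_ne_one, one_ne_zero, if_false] at e00 e01 e10 e11
    congr 1
    · linear_combination -z * e00 - w * e01
    · linear_combination -z * e10 - w * e11
  constructor <;> intro z w hzw <;> obtain ⟨z', w', h', e, hQ⟩ := key z w hzw
  · change _ ∈ mobiusImage m c.bdry ↔ _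
    rw [mem_mobiusImage_iff, e, hc.bdry _ _ h', hQ]
    simp [hκ.ne']
  · change _ ∈ mobiusImage m c.inner ↔ _
    rw [mem_mobiusImage_iff, e, hc.inner _ _ h', hQ]
    simp [mul_neg_iff, hκ, hκ.le]

theorem SCircle.map_map (m m' : GL (Fin 2) ℂ) (c : SCircle) :
    (c.map m').map m = c.map (m * m') := by
  apply SCircle.ext <;> exact (mobiusImage_mul _ _ _).symm

theorem SCircle.map_one (c : SCircle) : c.map 1 = c := by
  apply SCircle.ext <;> simp [SCircle.map, mobiusImage]

theorem SCircle.map_map_inv (m : GL (Fin 2) ℂ) (c : SCircle) : (c.map m).map m⁻¹ = c := by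
  rw [SCircle.map_map, inv_mul_cancel, SCircle.map_one]

/-- The circle moves by `m⁻¹`, but the identity is checked for `m`, so no inverse matrix has to be
computed. -/
theorem HasForm.of_map {c : SCircle} {Q Q' : ℂ → ℂ → ℝ} (m : GL (Fin 2) ℂ) (hc : HasForm c Q')
    {κ : ℝ} (hκ : 0 < κ)
    (h : ∀ z w, Q' (m 0 0 * z + m 0 1 * w) (m 1 0 * z + m 1 1 * w) = κ * Q z w) :
    HasForm (c.map m⁻¹) Q := by
  have e : ∀ z w : ℂ, (z ≠ 0 ∨ w ≠ 0) → ∀ S, homog z w ∈ mobiusImage m⁻¹ S ↔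
      homog (m 0 0 * z + m 0 1 * w) (m 1 0 * z + m 1 1 * w) ∈ S := by
    intro z w hzw S
    rw [mem_mobiusImage_iff, inv_inv, smul_homog m hzw]
  constructor <;> intro z w hzw
  · rw [show (c.map m⁻¹).bdry = mobiusImage m⁻¹ c.bdry from rfl, e z w hzw,
      hc.bdry _ _ (mulVec_ne_zero m hzw), h]
    simp [hκ.ne']
  · rw [show (c.map m⁻¹).inner = mobiusImage m⁻¹ c.inner from rfl, e z w hzw,
      hc.inner _ _ (mulVec_ne_zero m hzw), h]
    simp [mul_neg_iff, hκ, hκ.le]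

theorem smul_eq_of_matrix_eq {m m' : GL (Fin 2) ℂ} {k : ℂ}
    (h : (m : Matrix (Fin 2) (Fin 2) ℂ) = k • (m' : Matrix (Fin 2) (Fin 2) ℂ)) (p : Sphere) :
    m • p = m' • p := by
  obtain ⟨z, w, hzw, rfl⟩ := exists_homog p
  rw [smul_homog _ hzw, smul_homog _ hzw,
    homog_eq_homog_iff (mulVec_ne_zero _ hzw) (mulVec_ne_zero _ hzw)]
  simp only [h, Matrix.smul_apply, smul_eq_mul]
  ring

theorem SCircle.map_eq_of_matrix_eq {m m' : GL (Fin 2) ℂ} {k : ℂ}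
    (h : (m : Matrix (Fin 2) (Fin 2) ℂ) = k • (m' : Matrix (Fin 2) (Fin 2) ℂ)) (c : SCircle) :
    c.map m = c.map m' := by
  have e := funext (smul_eq_of_matrix_eq h)
  apply SCircle.ext <;> simp only [SCircle.map, mobiusImage, e]

theorem SCircle.Tangent.symm {c d : SCircle} (h : c.Tangent d) : d.Tangent c :=
  ⟨by rw [Set.inter_comm]; exact h.1, h.2.symm⟩

theorem mobiusImage_inter (m : GL (Fin 2) ℂ) (S T : Set Sphere) :
    mobiusImage m S ∩ mobiusImage m T = mobiusImage m (S ∩ T) :=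
  (Set.image_inter (MulAction.injective m)).symm

theorem map_bdry_inter (m : GL (Fin 2) ℂ) {c d : SCircle} {p : Sphere}
    (h : c.bdry ∩ d.bdry = {p}) : (c.map m).bdry ∩ (d.map m).bdry = {m • p} := by
  change mobiusImage m _ ∩ mobiusImage m _ = _
  rw [mobiusImage_inter, h]
  simp [mobiusImage]

theorem SCircle.Tangent.map {c d : SCircle} (h : c.Tangent d) (m : GL (Fin 2) ℂ) :
    (c.map m).Tangent (d.map m) := by
  obtain ⟨⟨p, hp⟩, hd⟩ := h
  exact ⟨⟨_, map_bdry_inter m hp⟩,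
    (Set.disjoint_image_iff (MulAction.injective m)).2 hd⟩

theorem hasForm_euclid (z₀ : ℂ) (r : ℝ) (hr : 0 < r) :
    HasForm (SCircle.euclid z₀ r hr)
      fun z w => Complex.normSq (z - z₀ * w) - r ^ 2 * Complex.normSq w := by
  have key : ∀ z w : ℂ, w ≠ 0 → Complex.normSq (z - z₀ * w) - r ^ 2 * Complex.normSq w =
      ‖w‖ ^ 2 * (‖z / w - z₀‖ ^ 2 - r ^ 2) := by
    intro z w hw
    rw [Complex.normSq_eq_norm_sq, Complex.normSq_eq_norm_sq,
      show z - z₀ * w = w * (z / w - z₀) by field_simp, norm_mul]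
    ring
  have hsq : ∀ x : ℝ, 0 ≤ x → (x ^ 2 - r ^ 2 < 0 ↔ x < r) := by
    intro x hx
    rw [sub_neg, sq_lt_sq₀ hx hr.le]
  have hsq' : ∀ x : ℝ, 0 ≤ x → (x ^ 2 - r ^ 2 = 0 ↔ x = r) := by
    intro x hx
    rw [sub_eq_zero, sq_eq_sq₀ hx hr.le]
  constructor <;> intro z w hzw <;> by_cases hw : w = 0
  · have hz : z ≠ 0 := by simpa [hw] using hzw
    simp [SCircle.euclid, euclidBdry, hw, homog, hz]
  · have hw' : 0 < ‖w‖ ^ 2 := by positivity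
    rw [key z w hw, mul_eq_zero, or_iff_right hw'.ne', hsq' _ (norm_nonneg _)]
    simp [SCircle.euclid, euclidBdry, hw, homog]
  · have hz : z ≠ 0 := by simpa [hw] using hzw
    simp only [SCircle.euclid, euclidInner, hw, homog]
    simpa using Complex.normSq_nonneg z
  · have hw' : 0 < ‖w‖ ^ 2 := by positivity
    rw [key z w hw, mul_neg_iff]
    simp only [hw', not_lt.2 hw'.le, true_and, false_and, or_false]
    rw [hsq _ (norm_nonneg _)]
    simp [SCircle.euclid, euclidInner, hw, homog, dist_eq_norm]

/-! ### Horodiscs as real vectors. -/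

open Matrix.SpecialLinearGroup in
theorem mapGL_apply (g : Matrix.SpecialLinearGroup (Fin 2) ℝ) (i j : Fin 2) :
    (mapGL ℂ g) i j = ((g i j : ℝ) : ℂ) := by
  simp [mapGL_coe_matrix]

/-- The Hermitian form of the lower half plane. -/
def lineForm (z w : ℂ) : ℝ := z.im * w.re - z.re * w.im

/-- The Hermitian form of the disc in the upper half plane that is tangent to the real line at
`p / q` and has Euclidean diameter `1 / q ^ 2`; for `q = 0` it is the half plane `p ^ 2 < Im z`. -/
def horoForm (p q : ℝ) (z w : ℂ) : ℝ := Complex.normSq (q * z - p * w) - lineForm z w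

theorem horoForm_neg (p q : ℝ) : horoForm (-p) (-q) = horoForm p q := by
  funext z w
  unfold horoForm
  rw [← Complex.normSq_neg]
  congr 2
  push_cast
  ring

theorem HasForm.line_map {c : SCircle} (h : HasForm c lineForm)
    (g : Matrix.SpecialLinearGroup (Fin 2) ℝ) :
    HasForm (c.map (Matrix.SpecialLinearGroup.mapGL ℂ g)) lineForm := by
  refine h.map _ one_pos fun z w => ?_
  have hd := g.det_coe
  rw [Matrix.det_fin_two] at hd
  simp only [mapGL_apply, lineForm, Complex.add_im, Complex.add_re, Complex.re_ofReal_mul,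
    Complex.im_ofReal_mul]
  linear_combination (z.im * w.re - z.re * w.im) * hd

/-- Both terms of `horoForm` are invariant: q z - p w is the determinant of (z, w) and (p, q), and
`lineForm` is the imaginary part of z times the conjugate of w. So SL(2, ℝ) acts on horodiscs
through its linear action on (p, q). -/
theorem HasForm.horo_map {c : SCircle} {p q : ℝ} (h : HasForm c (horoForm p q))
    (g : Matrix.SpecialLinearGroup (Fin 2) ℝ) :
    HasForm (c.map (Matrix.SpecialLinearGroup.mapGL ℂ g))
      (horoForm (g 0 0 * p + g 0 1 * q) (g 1 0 * p + g 1 1 * q)) := by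
  refine h.map _ one_pos fun z w => ?_
  have hd := g.det_coe
  rw [Matrix.det_fin_two] at hd
  have hd' : ((g 0 0 : ℝ) : ℂ) * (g 1 1 : ℝ) - (g 0 1 : ℝ) * (g 1 0 : ℝ) = 1 := by
    exact_mod_cast hd
  unfold horoForm
  rw [one_mul]
  refine congrArg₂ (fun a b : ℝ => a - b) (congrArg Complex.normSq ?_) ?_
  · simp only [mapGL_apply]
    push_cast
    linear_combination (q * z - p * w) * hd'
  · simp only [mapGL_apply, lineForm, Complex.add_im, Complex.add_re, Complex.re_ofReal_mul,
      Complex.im_ofReal_mul]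
    linear_combination (z.im * w.re - z.re * w.im) * hd

/-! ### The base patch in the half plane coordinate. -/

theorem sq_sqrt_three : √3 ^ 2 = (3 : ℝ) := Real.sq_sqrt (by norm_num)

/-- The matrix of the Moebius transformation that takes the real line, with the lower half plane, to
`baseW` and its interior, and takes `∞`, `0`, `√3` to the points where `baseW` touches `baseV`,
`baseA`, `baseB`. -/
def baseFrame : GL (Fin 2) ℂ :=
  Matrix.GeneralLinearGroup.mkOfDetNeZero
    !![⟨-√3 / 2, 1 / 2⟩, ⟨-1 / 2, √3 / 2⟩; ⟨-√3 / 2, 1 / 2⟩, 1] (by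
      rw [Matrix.det_fin_two_of]
      intro h
      have := congrArg Complex.re h
      simp at this
      nlinarith [sqrt_three_pos, sq_sqrt_three])

theorem baseFrame_zero_zero : baseFrame 0 0 = ⟨-√3 / 2, 1 / 2⟩ := rfl
theorem baseFrame_zero_one : baseFrame 0 1 = ⟨-1 / 2, √3 / 2⟩ := rfl
theorem baseFrame_one_zero : baseFrame 1 0 = ⟨-√3 / 2, 1 / 2⟩ := rfl
theorem baseFrame_one_one : baseFrame 1 1 = 1 := rfl

/-- The circle `baseW` in the coordinate given by `baseFrame`. -/
def lineW : SCircle := baseW.map baseFrame⁻¹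

/-- The circle `baseV` in the coordinate given by `baseFrame`. -/
def horoV : SCircle := baseV.map baseFrame⁻¹

/-- The circle `baseA` in the coordinate given by `baseFrame`. -/
def horoA : SCircle := baseA.map baseFrame⁻¹

/-- The circle `baseB` in the coordinate given by `baseFrame`. -/
def horoB : SCircle := baseB.map baseFrame⁻¹

theorem hasForm_lineW : HasForm lineW lineForm := by
  -- Why 6: the pulled-back form has determinant -r²|det|² = -3 · 3, and `lineForm` has -1/4, so κ²
  -- = 36. Every `horoForm` also has determinant -1/4, so the same factor serves all four circles.
  refine HasForm.of_map baseFrame (hasForm_euclid _ _ _) (κ := 6) (by norm_num) fun z w => ?_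
  simp only [baseFrame_zero_zero, baseFrame_zero_one, baseFrame_one_zero, baseFrame_one_one,
    lineForm, Complex.normSq_apply, Complex.add_re, Complex.add_im, Complex.mul_re,
    Complex.mul_im, Complex.sub_re, Complex.sub_im, Complex.one_re, Complex.one_im]
  have h2 := sq_sqrt_three
  have h3 : √3 ^ 3 = 3 * √3 := by rw [pow_succ, h2]
  ring_nf
  simp only [h2, h3]
  ring

theorem hasForm_horoV : HasForm horoV (horoForm 1 0) := by
  refine HasForm.of_map baseFrame (hasForm_euclid _ _ _) (κ := 6) (by norm_num) fun z w => ?_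
  simp only [baseFrame_zero_zero, baseFrame_zero_one, baseFrame_one_zero, baseFrame_one_one,
    lineForm, horoForm, Complex.normSq_apply, Complex.add_re, Complex.add_im, Complex.mul_re,
    Complex.mul_im, Complex.sub_re, Complex.sub_im, Complex.one_re, Complex.one_im,
    Complex.ofReal_re, Complex.ofReal_im]
  have h2 := sq_sqrt_three
  have h3 : √3 ^ 3 = 3 * √3 := by rw [pow_succ, h2]
  ring_nf
  simp only [h2, h3]
  ring

theorem hasForm_horoA : HasForm horoA (horoForm 0 1) := by
  refine HasForm.of_map baseFrame (hasForm_euclid _ _ _) (κ := 6) (by norm_num) fun z w => ?_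
  simp only [baseFrame_zero_zero, baseFrame_zero_one, baseFrame_one_zero, baseFrame_one_one,
    lineForm, horoForm, Complex.normSq_apply, Complex.add_re, Complex.add_im, Complex.mul_re,
    Complex.mul_im, Complex.sub_re, Complex.sub_im, Complex.one_re, Complex.one_im,
    Complex.ofReal_re, Complex.ofReal_im, Complex.neg_re, Complex.neg_im,
    Complex.re_ofNat, Complex.im_ofNat]
  have h2 := sq_sqrt_three
  have h3 : √3 ^ 3 = 3 * √3 := by rw [pow_succ, h2]
  have h4 : √3 ^ 4 = (9 : ℝ) := by rw [show (4 : ℕ) = 2 * 2 from rfl, pow_mul, h2]; norm_num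
  ring_nf
  simp only [h2, h3, h4]
  ring

theorem hasForm_horoB : HasForm horoB (horoForm √3 1) := by
  refine HasForm.of_map baseFrame (hasForm_euclid _ _ _) (κ := 6) (by norm_num) fun z w => ?_
  simp only [baseFrame_zero_zero, baseFrame_zero_one, baseFrame_one_zero, baseFrame_one_one,
    lineForm, horoForm, Complex.normSq_apply, Complex.add_re, Complex.add_im, Complex.mul_re,
    Complex.mul_im, Complex.sub_re, Complex.sub_im, Complex.one_re, Complex.one_im,
    Complex.ofReal_re, Complex.ofReal_im, Complex.re_ofNat, Complex.im_ofNat]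
  have h2 := sq_sqrt_three
  have h3 : √3 ^ 3 = 3 * √3 := by rw [pow_succ, h2]
  have h4 : √3 ^ 4 = (9 : ℝ) := by rw [show (4 : ℕ) = 2 * 2 from rfl, pow_mul, h2]; norm_num
  ring_nf
  simp only [h2, h3, h4]
  ring


/-! ### The schwarzian as a translation length. -/

/-- The parabolic matrix `z ↦ z + t`. -/
def translation (t : ℝ) : Matrix.SpecialLinearGroup (Fin 2) ℝ := ⟨!![1, t; 0, 1], by simp⟩

/-- The matrix that takes two successive vectors of a flower to the next two. -/
def stepMatrix (a : ℝ) : Matrix.SpecialLinearGroup (Fin 2) ℝ := ⟨!![a, -1; 1, 0], by simp⟩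

theorem coe_translation (t : ℝ) :
    ((Matrix.SpecialLinearGroup.mapGL ℂ (translation t) : GL (Fin 2) ℂ) :
      Matrix (Fin 2) (Fin 2) ℂ) = !![1, (t : ℂ); 0, 1] := by
  ext i j
  rw [mapGL_apply]
  fin_cases i <;> fin_cases j <;> simp [translation]

theorem coe_stepMatrix (a : ℝ) :
    ((Matrix.SpecialLinearGroup.mapGL ℂ (stepMatrix a) : GL (Fin 2) ℂ) :
      Matrix (Fin 2) (Fin 2) ℂ) = !![(a : ℂ), -1; 1, 0] := by
  ext i j
  rw [mapGL_apply]
  fin_cases i <;> fin_cases j <;> simp [stepMatrix]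

/-- `M_s` is parabolic with fixed point 1, where `baseV` and `baseW` touch; `baseFrame` puts this
point at ∞. -/
theorem edgeMatrix_mul_baseFrame (s : ℝ) :
    edgeMatrix s * (baseFrame : Matrix (Fin 2) (Fin 2) ℂ) =
      baseFrame * (Matrix.SpecialLinearGroup.mapGL ℂ (translation (√3 * s)) : GL (Fin 2) ℂ) := by
  have h2 := Real.mul_self_sqrt (show (0:ℝ) ≤ 3 by norm_num)
  rw [coe_translation]
  ext i j
  fin_cases i <;> fin_cases j <;> apply Complex.ext <;>
    simp [Matrix.mul_apply, Fin.sum_univ_two, baseFrame_zero_zero,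
      baseFrame_zero_one, baseFrame_one_zero, baseFrame_one_one, edgeMatrix] <;>
    first | ring1 | linear_combination (s / 2) * h2

/-- `HasSchwarzian` in the coordinate given by `baseFrame`. -/
theorem hasSchwarzian_iff (v w a b : SCircle) (s : ℝ) : HasSchwarzian v w a b s ↔
    ∃ mf mg : GL (Fin 2) ℂ,
      (horoV.map mf = v ∧ lineW.map mf = w ∧ horoA.map mf = a) ∧
      (horoV.map mg = v ∧ lineW.map mg = w ∧ horoB.map mg = b) ∧
      ∃ k : ℂ, k ≠ 0 ∧ (mf : Matrix (Fin 2) (Fin 2) ℂ) =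
        k • ((mg * Matrix.SpecialLinearGroup.mapGL ℂ (translation (√3 * s)) : GL (Fin 2) ℂ) :
          Matrix (Fin 2) (Fin 2) ℂ) := by
  have hinv : ∀ g : GL (Fin 2) ℂ, (g : Matrix (Fin 2) (Fin 2) ℂ) * (g⁻¹ : GL (Fin 2) ℂ) = 1 :=
    fun g => by rw [← Matrix.GeneralLinearGroup.coe_mul, mul_inv_cancel]; rfl
  constructor
  · rintro ⟨mf, mg, ⟨h1, h2, h3⟩, ⟨h4, h5, h6⟩, k, hk, h⟩
    have e : ∀ (c : SCircle) (m : GL (Fin 2) ℂ), (c.map baseFrame⁻¹).map (m * baseFrame) = c.map m :=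
      fun c m => by rw [SCircle.map_map, mul_inv_cancel_right]
    refine ⟨mf * baseFrame, mg * baseFrame, ⟨(e _ _).trans h1, (e _ _).trans h2, (e _ _).trans h3⟩,
      ⟨(e _ _).trans h4, (e _ _).trans h5, (e _ _).trans h6⟩, k, hk, ?_⟩
    have : mf = mg * (mg⁻¹ * mf) := by group
    rw [this]
    simp only [Matrix.GeneralLinearGroup.coe_mul] at h ⊢
    rw [h, Matrix.mul_assoc, Matrix.smul_mul, edgeMatrix_mul_baseFrame, Matrix.mul_smul,
      Matrix.mul_assoc]
  · rintro ⟨mf, mg, ⟨h1, h2, h3⟩, ⟨h4, h5, h6⟩, k, hk, h⟩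
    have e : ∀ (c : SCircle) (m : GL (Fin 2) ℂ), c.map (m * baseFrame⁻¹) = (c.map baseFrame⁻¹).map m :=
      fun c m => by rw [SCircle.map_map]
    refine ⟨mf * baseFrame⁻¹, mg * baseFrame⁻¹,
      ⟨(e _ _).trans h1, (e _ _).trans h2, (e _ _).trans h3⟩,
      ⟨(e _ _).trans h4, (e _ _).trans h5, (e _ _).trans h6⟩, k, hk, ?_⟩
    have h' : (mf : Matrix (Fin 2) (Fin 2) ℂ) * (baseFrame⁻¹ : GL (Fin 2) ℂ) =
        k • ((mg : Matrix (Fin 2) (Fin 2) ℂ) * (baseFrame⁻¹ : GL (Fin 2) ℂ) * edgeMatrix s) := by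
      have : edgeMatrix s = baseFrame *
          (Matrix.SpecialLinearGroup.mapGL ℂ (translation (√3 * s)) : GL (Fin 2) ℂ) *
          (baseFrame⁻¹ : GL (Fin 2) ℂ) := by
        rw [← edgeMatrix_mul_baseFrame, Matrix.mul_assoc, hinv, Matrix.mul_one]
      rw [h, this, ← Matrix.GeneralLinearGroup.coe_mul, ← Matrix.GeneralLinearGroup.coe_mul,
        ← Matrix.GeneralLinearGroup.coe_mul, ← Matrix.GeneralLinearGroup.coe_mul, Matrix.smul_mul,
        ← Matrix.GeneralLinearGroup.coe_mul]
      congr 2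
      group
    rw [Matrix.GeneralLinearGroup.coe_mul, Matrix.GeneralLinearGroup.coe_mul, h', Matrix.mul_smul,
      ← Matrix.GeneralLinearGroup.coe_mul, ← Matrix.mul_assoc, ← Matrix.GeneralLinearGroup.coe_mul,
      inv_mul_cancel, Matrix.GeneralLinearGroup.coe_one, Matrix.one_mul]

/-! ### Tangency points. -/

theorem bdry_inter_eq_singleton {c d : SCircle} {Q Q' : ℂ → ℂ → ℝ} (hc : HasForm c Q)
    (hd : HasForm d Q') {z₀ w₀ : ℂ} (h₀ : z₀ ≠ 0 ∨ w₀ ≠ 0)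
    (h : ∀ z w, z * w₀ = z₀ * w ↔ Q z w = 0 ∧ Q' z w = 0) :
    c.bdry ∩ d.bdry = {homog z₀ w₀} := by
  ext p
  obtain ⟨z, w, hzw, rfl⟩ := exists_homog p
  rw [Set.mem_inter_iff, hc.bdry z w hzw, hd.bdry z w hzw, Set.mem_singleton_iff,
    homog_eq_homog_iff hzw h₀, h]

theorem disjoint_inner {c d : SCircle} {Q Q' : ℂ → ℂ → ℝ} (hc : HasForm c Q)
    (hd : HasForm d Q') (h : ∀ z w, Q z w < 0 → 0 ≤ Q' z w) : Disjoint c.inner d.inner := by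
  rw [Set.disjoint_left]
  intro p hp hp'
  obtain ⟨z, w, hzw, rfl⟩ := exists_homog p
  rw [hc.inner z w hzw] at hp
  rw [hd.inner z w hzw] at hp'
  exact absurd hp' (not_lt.2 (h z w hp))

theorem line_inter_horo {c d : SCircle} {p q : ℝ} (hc : HasForm c lineForm)
    (hd : HasForm d (horoForm p q)) (hpq : p ≠ 0 ∨ q ≠ 0) :
    c.bdry ∩ d.bdry = {homog p q} := by
  refine bdry_inter_eq_singleton hc hd (by simpa using hpq) fun z w => ?_
  unfold horoForm
  constructor
  · intro h
    have h1 : (q : ℂ) * z - p * w = 0 := by linear_combination h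
    have h2 : lineForm z w = 0 := by
      have hre := congrArg Complex.re h
      have him := congrArg Complex.im h
      simp only [Complex.mul_re, Complex.mul_im, Complex.ofReal_re, Complex.ofReal_im, mul_zero,
        zero_mul, sub_zero, add_zero, zero_add] at hre him
      unfold lineForm
      rcases hpq with hp | hq
      · apply mul_left_cancel₀ hp
        linear_combination z.re * him - z.im * hre
      · apply mul_left_cancel₀ hq
        linear_combination w.re * him - w.im * hre
    simp [h1, h2]
  · rintro ⟨h1, h2⟩
    rw [h1, sub_zero, Complex.normSq_eq_zero] at h2
    linear_combination h2

theorem line_disjoint_horo {c d : SCircle} {p q : ℝ} (hc : HasForm c lineForm)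
    (hd : HasForm d (horoForm p q)) : Disjoint c.inner d.inner :=
  disjoint_inner hc hd fun z w h => by
    have := Complex.normSq_nonneg ((q : ℂ) * z - p * w)
    unfold horoForm
    linarith

theorem lineW_inter_horoV : lineW.bdry ∩ horoV.bdry = {OnePoint.infty} := by
  simpa [homog] using line_inter_horo hasForm_lineW hasForm_horoV (by simp)

theorem lineW_inter_horoA : lineW.bdry ∩ horoA.bdry = {((0 : ℂ) : Sphere)} := by
  simpa [homog] using line_inter_horo hasForm_lineW hasForm_horoA (by simp)

theorem lineW_inter_horoB : lineW.bdry ∩ horoB.bdry = {(((√3 : ℝ) : ℂ) : Sphere)} := by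
  simpa [homog] using line_inter_horo hasForm_lineW hasForm_horoB (by simp)

/-- The two forms add up to |z - (t + i) w|², so their common zeros are those of this square. Its
nonnegativity, for t = 0, is also what makes the interiors disjoint in `horoA_tangent_horoV`. -/
theorem horoV_inter_horo {c : SCircle} {t : ℝ} (hc : HasForm c (horoForm t 1)) :
    horoV.bdry ∩ c.bdry = {homog (t + Complex.I) 1} := by
  refine bdry_inter_eq_singleton hasForm_horoV hc (by simp) fun z w => ?_
  simp only [horoForm, lineForm, Complex.normSq_apply, Complex.ext_iff, Complex.mul_re,
    Complex.mul_im, Complex.sub_re, Complex.sub_im, Complex.ofReal_re, Complex.ofReal_im,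
    Complex.add_re, Complex.add_im, Complex.I_re, Complex.I_im, Complex.one_re, Complex.one_im]
  constructor
  · rintro ⟨h1, h2⟩
    have h1' : z.re = t * w.re - w.im := by linarith
    have h2' : z.im = t * w.im + w.re := by linarith
    rw [h1', h2']
    constructor <;> ring
  · rintro ⟨h1, h2⟩
    have : (z.re - (t * w.re - w.im)) ^ 2 + (z.im - (t * w.im + w.re)) ^ 2 = 0 := by
      linear_combination h1 + h2
    have h3 : (z.re - (t * w.re - w.im)) ^ 2 = 0 := by
      nlinarith [sq_nonneg (z.re - (t * w.re - w.im)), sq_nonneg (z.im - (t * w.im + w.re))]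
    have h4 : (z.im - (t * w.im + w.re)) ^ 2 = 0 := by
      nlinarith [sq_nonneg (z.re - (t * w.re - w.im)), sq_nonneg (z.im - (t * w.im + w.re))]
    rw [sq_eq_zero_iff] at h3 h4
    constructor <;> linarith

theorem horoV_inter_horoA : horoV.bdry ∩ horoA.bdry = {(Complex.I : Sphere)} := by
  simpa [homog] using horoV_inter_horo hasForm_horoA

theorem horoV_inter_horoB :
    horoV.bdry ∩ horoB.bdry = {(((√3 : ℝ) + Complex.I : ℂ) : Sphere)} := by
  simpa [homog] using horoV_inter_horo hasForm_horoB

theorem lineW_tangent_horoV : lineW.Tangent horoV :=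
  ⟨⟨_, lineW_inter_horoV⟩, line_disjoint_horo hasForm_lineW hasForm_horoV⟩

theorem horoA_tangent_horoV : horoA.Tangent horoV :=
  SCircle.Tangent.symm ⟨⟨_, horoV_inter_horoA⟩, by
    refine disjoint_inner hasForm_horoV hasForm_horoA fun z w h => ?_
    simp only [horoForm, lineForm, Complex.normSq_apply, Complex.mul_re, Complex.mul_im,
      Complex.sub_re, Complex.sub_im, Complex.ofReal_re, Complex.ofReal_im] at h ⊢
    nlinarith [sq_nonneg (z.im - w.re), sq_nonneg (z.re + w.im)]⟩

/-! ### Frames and continuants. -/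

/-- The product of the step matrices of `a_0, …, a_{j-1}`. -/
def frame (a : ℕ → ℝ) : ℕ → Matrix.SpecialLinearGroup (Fin 2) ℝ
  | 0 => 1
  | j + 1 => frame a j * stepMatrix (a j)

theorem frame_succ_zero (a : ℕ → ℝ) (j : ℕ) (i : Fin 2) :
    frame a (j + 1) i 0 = a j * frame a j i 0 + frame a j i 1 := by
  rw [frame, Matrix.SpecialLinearGroup.coe_mul, Matrix.mul_apply, Fin.sum_univ_two]
  simp [stepMatrix, mul_comm]

theorem frame_succ_one (a : ℕ → ℝ) (j : ℕ) (i : Fin 2) :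
    frame a (j + 1) i 1 = -frame a j i 0 := by
  rw [frame, Matrix.SpecialLinearGroup.coe_mul, Matrix.mul_apply, Fin.sum_univ_two]
  simp [stepMatrix]

/-- The determinant of the first columns of two frames. -/
def wedge (a : ℕ → ℝ) (i j : ℕ) : ℝ :=
  frame a i 0 0 * frame a j 1 0 - frame a i 1 0 * frame a j 0 0

theorem wedge_self (a : ℕ → ℝ) (i : ℕ) : wedge a i i = 0 := by unfold wedge; ring

theorem wedge_swap (a : ℕ → ℝ) (i j : ℕ) : wedge a i j = -wedge a j i := by unfold wedge; ring

theorem wedge_succ (a : ℕ → ℝ) (i : ℕ) : wedge a i (i + 1) = 1 := by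
  have h := (frame a (i + 1)).det_coe
  rw [Matrix.det_fin_two, frame_succ_one, frame_succ_one] at h
  unfold wedge
  linear_combination h

theorem wedge_add_two (a : ℕ → ℝ) (i j : ℕ) :
    wedge a i (j + 2) = a (j + 1) * wedge a i (j + 1) - wedge a i j := by
  unfold wedge
  rw [frame_succ_zero a (j + 1), frame_succ_zero a (j + 1), frame_succ_one, frame_succ_one]
  ring

theorem wedge_zero_left (a : ℕ → ℝ) (j : ℕ) : wedge a 0 j = frame a j 1 0 := by
  simp [wedge, frame]

/-- Both sides obey the same three-term recursion with initial values 0 and 1. The shift `i` lets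
one statement serve all three formulas of the theorem. -/
theorem cPoly_eq_wedge (v a : ℕ → ℝ) (ha : ∀ j, a j = √3 * v j) (i j : ℕ) :
    cPoly j (fun k => v (k + i)) = wedge a i (i + j) := by
  induction j using Nat.twoStepInduction with
  | zero => simp [cPoly, wedge_self]
  | one => simp [cPoly, wedge_succ]
  | more j h₁ h₂ =>
    rw [cPoly, h₁, h₂, ← add_assoc, ← add_assoc, wedge_add_two, ha,
      show i + j + 1 = j + 1 + i by ring]

theorem cPoly_congr {x y : ℕ → ℝ} (j : ℕ) (h : ∀ k, 1 ≤ k → k < j → x k = y k) :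
    cPoly j x = cPoly j y := by
  induction j using Nat.twoStepInduction with
  | zero => rfl
  | one => rfl
  | more j h₁ h₂ =>
    rw [cPoly, cPoly, h₁ fun k hk hj => h k hk (by omega), h₂ fun k hk hj => h k hk (by omega),
      h (j + 1) (by omega) (by omega)]

/-- The frames of an un-branched flower close up with a change of sign. -/
theorem frame_add {a : ℕ → ℝ} {n : ℕ} (hper : ∀ j, a (j + n) = a j) (hn : frame a n = -1) (j : ℕ) :
    frame a (j + n) = -frame a j := by
  induction j with
  | zero => simpa [frame] using hn
  | succ j ih => rw [show j + 1 + n = j + n + 1 by ring, frame, frame, ih, hper, neg_mul]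

theorem eq_uFun_of_closed {v a : ℕ → ℝ} (ha : ∀ j, a j = √3 * v j) {n : ℕ} (hn : 3 < n)
    (hper : ∀ j, a (j + n) = a j) (hF : frame a n = -1) {i : ℕ}
    (hpos : wedge a i (i + (n - 2)) ≠ 0) :
    cPoly (n - 2) (fun k => v (k + i)) ≠ 0 ∧ v (i + (n - 2)) = uFun n (fun k => v (k + i)) := by
  obtain ⟨m, rfl⟩ : ∃ m, n = m + 3 := ⟨n - 3, by omega⟩
  simp only [show m + 3 - 2 = m + 1 by omega, show m + 3 - 3 = m by omega, uFun] at hpos ⊢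
  rw [cPoly_eq_wedge v a ha, cPoly_eq_wedge v a ha]
  refine ⟨hpos, ?_⟩
  rw [eq_div_iff (mul_ne_zero sqrt_three_pos.ne' hpos)]
  have h1 := wedge_add_two a i (i + m)
  have h2 := wedge_succ a (i + m + 2)
  have h3 := frame_add hper hF i
  -- Closing with a sign turns the last consecutive determinant, which is 1, into det(e_i,
  -- e_{i+n-1}).
  have h4 : wedge a (i + m + 2) (i + m + 2 + 1) = wedge a i (i + m + 2) := by
    unfold wedge
    rw [show i + m + 2 + 1 = i + (m + 3) by ring, h3]
    simp only [Matrix.SpecialLinearGroup.coe_neg, Matrix.neg_apply]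
    ring
  rw [← h4, h2, ha] at h1
  rw [← add_assoc]
  linear_combination -h1

/-- `mg` at one petal and `mf` at the next parametrise the same face with two petals exchanged. A
Moebius transformation is determined by three points; here the mutual tangency points ∞, √3, √3 + i
correspond to 0, ∞, i. -/
theorem step_of_faces {mf mg : GL (Fin 2) ℂ} (hW : lineW.map mg = lineW.map mf)
    (hA : horoV.map mg = horoA.map mf) (hB : horoB.map mg = horoV.map mf) :
    ∃ k : ℂ, k ≠ 0 ∧ (mf : Matrix (Fin 2) (Fin 2) ℂ) =
      k • ((mg * Matrix.SpecialLinearGroup.mapGL ℂ (stepMatrix √3) : GL (Fin 2) ℂ) :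
        Matrix (Fin 2) (Fin 2) ℂ) := by
  have e1 : mg • (OnePoint.infty : Sphere) = mf • ((0 : ℂ) : Sphere) := by
    apply Set.singleton_injective
    rw [← map_bdry_inter mg lineW_inter_horoV, ← map_bdry_inter mf lineW_inter_horoA, hW, hA]
  have e2 : mg • (((√3 : ℝ) : ℂ) : Sphere) = mf • (OnePoint.infty : Sphere) := by
    apply Set.singleton_injective
    rw [← map_bdry_inter mg lineW_inter_horoB, ← map_bdry_inter mf lineW_inter_horoV, hW, hB]
  have e3 : mg • (((√3 : ℝ) + Complex.I : ℂ) : Sphere) = mf • (Complex.I : Sphere) := by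
    apply Set.singleton_injective
    rw [← map_bdry_inter mg horoV_inter_horoB, ← map_bdry_inter mf horoV_inter_horoA, hA, hB,
      Set.inter_comm]
  obtain ⟨G, rfl⟩ : ∃ G, mg = mf * G := ⟨mf⁻¹ * mg, by group⟩
  rw [mul_smul, smul_left_cancel_iff] at e1 e2 e3
  have hd := G.det_ne_zero
  rw [Matrix.det_fin_two] at hd
  rw [← homog_zero (z := 1), ← homog_one, smul_homog _ (by simp),
    homog_eq_homog_iff (mulVec_ne_zero _ (by simp)) (by simp)] at e1
  rw [← homog_zero (z := 1), ← homog_one, smul_homog _ (by simp),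
    homog_eq_homog_iff (mulVec_ne_zero _ (by simp)) (by simp)] at e2
  rw [← homog_one, ← homog_one, smul_homog _ (by simp),
    homog_eq_homog_iff (mulVec_ne_zero _ (by simp)) (by simp)] at e3
  have f1 : G 0 0 = 0 := by linear_combination e1
  have f2 : G 1 1 = -√3 * G 1 0 := by linear_combination -e2
  have f3 : G 0 1 = -G 1 0 := by
    rw [f1, f2] at e3
    linear_combination e3 + G 1 0 * Complex.I_sq
  have f4 : G 1 0 ≠ 0 := by
    intro h
    rw [f1, h] at hd
    simp at hd
  refine ⟨-(G 1 0)⁻¹, neg_ne_zero.2 (inv_ne_zero f4), ?_⟩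
  have hG : (G : Matrix (Fin 2) (Fin 2) ℂ) * !![((√3 : ℝ) : ℂ), -1; 1, 0] = (-G 1 0) • 1 := by
    ext i j
    fin_cases i <;> fin_cases j <;>
      simp [Matrix.mul_apply, Fin.sum_univ_two, f1, f2, f3, mul_comm]
  rw [Matrix.GeneralLinearGroup.coe_mul, Matrix.GeneralLinearGroup.coe_mul, coe_stepMatrix,
    Matrix.mul_assoc, hG, Matrix.mul_smul, Matrix.mul_one, smul_smul, neg_mul_neg,
    inv_mul_cancel₀ f4, one_smul]

/-! ### From a flower to its frames. -/

/-- The Cayley transformation, from the lower half plane to the unit disc. -/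
def cayley : GL (Fin 2) ℂ :=
  Matrix.GeneralLinearGroup.mkOfDetNeZero !![1, Complex.I; 1, -Complex.I] (by
    rw [Matrix.det_fin_two_of]
    intro h
    have := congrArg Complex.im h
    norm_num at this)

theorem lineW_map_cayley : lineW.map cayley = SCircle.euclid 0 1 one_pos := by
  refine HasForm.ext (hasForm_lineW.map cayley (κ := 4) (by norm_num) fun z w => ?_)
    (hasForm_euclid 0 1 one_pos)
  change Complex.normSq (1 * z + Complex.I * w - 0 * (1 * z + -Complex.I * w)) -
    1 ^ 2 * Complex.normSq (1 * z + -Complex.I * w) = _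
  simp only [lineForm, Complex.normSq_apply, Complex.add_re, Complex.add_im, Complex.mul_re,
    Complex.mul_im, Complex.sub_re, Complex.sub_im, Complex.one_re, Complex.one_im,
    Complex.I_re, Complex.I_im, Complex.neg_re, Complex.neg_im, Complex.zero_re, Complex.zero_im]
  ring

theorem cos_sin_ne_zero (t : ℝ) : ((Real.cos t : ℝ) : ℂ) ≠ 0 ∨ ((Real.sin t : ℝ) : ℂ) ≠ 0 := by
  by_contra! h
  have := Real.cos_sq_add_sin_sq t
  simp [Complex.ofReal_eq_zero.1 h.1, Complex.ofReal_eq_zero.1 h.2] at this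

/-- (cos + i sin)/(cos - i sin) doubles the angle: a real vector at angle t/2 goes to the point at
angle t. -/
theorem cayley_smul (t : ℝ) :
    cayley • homog (Real.cos (t / 2) : ℝ) (Real.sin (t / 2) : ℝ) =
      ((Complex.exp (t * Complex.I) : ℂ) : Sphere) := by
  rw [smul_homog _ (cos_sin_ne_zero _), ← homog_one, homog_eq_homog_iff
    (mulVec_ne_zero _ (cos_sin_ne_zero _)) (by simp)]
  change (1 * _ + Complex.I * _) * 1 = _ * (1 * _ + -Complex.I * _)
  have h : Complex.exp (t * Complex.I) = (Complex.exp ((t / 2 : ℝ) * Complex.I)) ^ 2 := by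
    rw [← Complex.exp_nat_mul]
    congr 1
    push_cast
    ring
  have h1 := Real.cos_sq_add_sin_sq (t / 2)
  have h2 : ((Real.cos (t / 2) : ℝ) : ℂ) ^ 2 + ((Real.sin (t / 2) : ℝ) : ℂ) ^ 2 = 1 := by
    exact_mod_cast h1
  rw [h, Complex.exp_mul_I, ← Complex.ofReal_cos, ← Complex.ofReal_sin]
  set c : ℂ := ((Real.cos (t / 2) : ℝ) : ℂ)
  set d : ℂ := ((Real.sin (t / 2) : ℝ) : ℂ)
  linear_combination (-(c + d * Complex.I)) * h2 + (c + d * Complex.I) * d ^ 2 * Complex.I_sq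

/-- A Moebius transformation that preserves the lower half plane multiplies the determinants of real
vectors, in a suitable hermitian sense, by a positive number. -/
theorem exists_pos_of_lineW_map {N : GL (Fin 2) ℂ} (h : lineW.map N = lineW) :
    ∃ κ : ℝ, 0 < κ ∧ ∀ p q p' q' : ℝ,
      (starRingEnd ℂ) (N 0 0 * p + N 0 1 * q) * (N 1 0 * p' + N 1 1 * q') -
        (starRingEnd ℂ) (N 1 0 * p + N 1 1 * q) * (N 0 0 * p' + N 0 1 * q') =
      ((κ * (p * q' - q * p') : ℝ) : ℂ) := by
  have hb : ∀ z w : ℂ, (z ≠ 0 ∨ w ≠ 0) → lineForm z w = 0 →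
      lineForm (N 0 0 * z + N 0 1 * w) (N 1 0 * z + N 1 1 * w) = 0 := by
    intro z w hzw h0
    rw [← hasForm_lineW.bdry _ _ (mulVec_ne_zero N hzw), ← smul_homog N hzw, ← h]
    exact (smul_mem_mobiusImage_iff _ _ _).2 ((hasForm_lineW.bdry _ _ hzw).2 h0)
  have hi : ∀ z w : ℂ, (z ≠ 0 ∨ w ≠ 0) → lineForm z w < 0 →
      lineForm (N 0 0 * z + N 0 1 * w) (N 1 0 * z + N 1 1 * w) < 0 := by
    intro z w hzw h0
    rw [← hasForm_lineW.inner _ _ (mulVec_ne_zero N hzw), ← smul_homog N hzw, ← h]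
    exact (smul_mem_mobiusImage_iff _ _ _).2 ((hasForm_lineW.inner _ _ hzw).2 h0)
  -- Vanishing at ∞, 0 and 1 forces the pullback of `lineForm` to be a multiple of it; the interior
  -- point -i gives the sign of the factor.
  have h1 := hb 1 0 (by simp) (by simp [lineForm])
  have h2 := hb 0 1 (by simp) (by simp [lineForm])
  have h3 := hb 1 1 (by simp) (by simp [lineForm])
  have h4 := hi (-Complex.I) 1 (by simp) (by simp [lineForm])
  simp only [lineForm, Complex.add_re, Complex.add_im, Complex.mul_re, Complex.mul_im,
    Complex.one_re, Complex.one_im, Complex.zero_re, Complex.zero_im, Complex.neg_re,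
    Complex.neg_im, Complex.I_re, Complex.I_im] at h1 h2 h3 h4
  ring_nf at h1 h2 h3 h4
  refine ⟨(N 0 0).re * (N 1 1).re + (N 0 0).im * (N 1 1).im - (N 1 0).re * (N 0 1).re -
    (N 1 0).im * (N 0 1).im, by linarith, fun p q p' q' => ?_⟩
  apply Complex.ext
  · simp
    ring
  · simp
    linear_combination (-2 * p * p') * h1 - 2 * q * q' * h2 - (p * q' + q * p') * (h3 - h1 - h2)

theorem exists_smul_of_homog_eq {z w z' w' : ℂ} (h : z ≠ 0 ∨ w ≠ 0) (h' : z' ≠ 0 ∨ w' ≠ 0)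
    (e : homog z w = homog z' w') : ∃ μ : ℂ, z = μ * z' ∧ w = μ * w' := by
  rw [homog_eq_homog_iff h h'] at e
  rcases h' with h' | h'
  · exact ⟨z / z', by field_simp, by field_simp; linear_combination -e⟩
  · exact ⟨w / w', by field_simp; linear_combination e, by field_simp⟩

theorem stepMatrix_eq (t a : ℝ) : translation (-t) * stepMatrix a = stepMatrix (a - t) := by
  ext i j
  rw [Matrix.SpecialLinearGroup.coe_mul, Matrix.mul_apply, Fin.sum_univ_two]
  fin_cases i <;> fin_cases j <;> simp [translation, stepMatrix, sub_eq_add_neg]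

theorem translation_mul_neg (t : ℝ) : translation t * translation (-t) = 1 := by
  ext i j
  rw [Matrix.SpecialLinearGroup.coe_mul, Matrix.mul_apply, Fin.sum_univ_two]
  fin_cases i <;> fin_cases j <;> simp [translation]

/-- The face maps of successive patches of a flower, in terms of the frames. -/
theorem exists_faceMaps {n : ℕ} {C : SCircle} {c : ZMod n → SCircle} {s : ZMod n → ℝ}
    (h : ∀ j, HasSchwarzian (c j) C (c (j - 1)) (c (j + 1)) (s j)) {a : ℕ → ℝ}
    (ha : ∀ j : ℕ, a j = √3 * (1 - s (j : ZMod n))) :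
    ∃ mf : ZMod n → GL (Fin 2) ℂ, (∀ j, lineW.map (mf j) = C ∧ horoV.map (mf j) = c j) ∧
      ∀ j : ℕ, ∃ k : ℂ, k ≠ 0 ∧ (mf (j : ZMod n) : Matrix (Fin 2) (Fin 2) ℂ) =
        k • ((mf 0 * Matrix.SpecialLinearGroup.mapGL ℂ (frame a j) : GL (Fin 2) ℂ) :
          Matrix (Fin 2) (Fin 2) ℂ) := by
  simp only [hasSchwarzian_iff] at h
  choose mf mg hf hg k hk hfg using h
  refine ⟨mf, fun j => ⟨(hf j).2.1, (hf j).1⟩, fun j => ?_⟩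
  induction j with
  | zero => exact ⟨1, one_ne_zero, by simp [frame]⟩
  | succ j ih =>
    obtain ⟨κ, hκ, ih⟩ := ih
    set i : ZMod n := (j : ZMod n) with hi
    have hi1 : ((j + 1 : ℕ) : ZMod n) = i + 1 := by rw [hi]; push_cast; rfl
    obtain ⟨r, hr, hstep⟩ := step_of_faces (mf := mf (i + 1)) (mg := mg i)
      (by rw [(hg i).2.1, (hf (i + 1)).2.1])
      (by rw [(hg i).1, (hf (i + 1)).2.2, add_sub_cancel_right])
      (by rw [(hg i).2.2, (hf (i + 1)).1])
    rw [hi1]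
    refine ⟨r * (k i)⁻¹ * κ, by simp [hr, hk, hκ], ?_⟩
    set T := Matrix.SpecialLinearGroup.mapGL (n := Fin 2) ℂ (translation (√3 * s i))
    set T' := Matrix.SpecialLinearGroup.mapGL (n := Fin 2) ℂ (translation (-(√3 * s i)))
    have hT : T * T' = 1 := by
      rw [← map_mul, translation_mul_neg, map_one]
    have hg' : (mg i : Matrix (Fin 2) (Fin 2) ℂ) =
        (k i)⁻¹ • ((mf i * T' : GL (Fin 2) ℂ) : Matrix (Fin 2) (Fin 2) ℂ) := by
      rw [Matrix.GeneralLinearGroup.coe_mul, hfg i, Matrix.smul_mul, smul_smul,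
        inv_mul_cancel₀ (hk i), one_smul, ← Matrix.GeneralLinearGroup.coe_mul, mul_assoc, hT,
        mul_one]
    -- Undoing the translation by √3 s before a step of parameter √3 leaves a step of parameter √3
    -- (1 - s): this is where u = 1 - s enters.
    have hX : T' * Matrix.SpecialLinearGroup.mapGL ℂ (stepMatrix √3) =
        Matrix.SpecialLinearGroup.mapGL ℂ (stepMatrix (a j)) := by
      rw [← map_mul, stepMatrix_eq, ha]
      congr 2
      ring
    rw [hstep, Matrix.GeneralLinearGroup.coe_mul, hg', Matrix.smul_mul,
      ← Matrix.GeneralLinearGroup.coe_mul, mul_assoc, hX, Matrix.GeneralLinearGroup.coe_mul, ih,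
      Matrix.smul_mul, ← Matrix.GeneralLinearGroup.coe_mul, frame, map_mul, mul_assoc (mf 0),
      smul_smul, smul_smul]

theorem frame_eq_one_or_neg_one {M : GL (Fin 2) ℂ} {g : Matrix.SpecialLinearGroup (Fin 2) ℝ} {k : ℂ}
    (hk : k ≠ 0) (h : (M : Matrix (Fin 2) (Fin 2) ℂ) =
      k • ((M * Matrix.SpecialLinearGroup.mapGL ℂ g : GL (Fin 2) ℂ) :
        Matrix (Fin 2) (Fin 2) ℂ)) : g = 1 ∨ g = -1 := by
  have h1 : (1 : Matrix (Fin 2) (Fin 2) ℂ) =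
      k • ((Matrix.SpecialLinearGroup.mapGL ℂ g : GL (Fin 2) ℂ) : Matrix (Fin 2) (Fin 2) ℂ) := by
    have := congrArg (fun A => ((M⁻¹ : GL (Fin 2) ℂ) : Matrix (Fin 2) (Fin 2) ℂ) * A) h
    simp only [Matrix.mul_smul, ← Matrix.GeneralLinearGroup.coe_mul, inv_mul_cancel,
      inv_mul_cancel_left, Matrix.GeneralLinearGroup.coe_one] at this
    exact this
  have e : ∀ i j, (1 : Matrix (Fin 2) (Fin 2) ℂ) i j = k * ((g i j : ℝ) : ℂ) := by
    intro i j
    rw [h1, Matrix.smul_apply, mapGL_apply, smul_eq_mul]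
  have e00 := e 0 0
  have e01 := e 0 1
  have e10 := e 1 0
  have e11 := e 1 1
  simp [hk] at e00 e01 e10 e11
  have e2 : g 0 0 = g 1 1 := by
    have := mul_left_cancel₀ hk (e00.symm.trans e11)
    exact_mod_cast this
  have hd := g.det_coe
  rw [Matrix.det_fin_two, e01, e10, ← e2] at hd
  rcases mul_self_eq_one_iff.1 (show g 0 0 * g 0 0 = 1 by linarith) with h0 | h0
  · left
    ext i j
    fin_cases i <;> fin_cases j <;> simp [e01, e10, ← e2, h0]
  · right
    ext i j
    fin_cases i <;> fin_cases j <;> simp [e01, e10, ← e2, h0]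

theorem frame_ne_zero (a : ℕ → ℝ) (j : ℕ) :
    ((frame a j 0 0 : ℝ) : ℂ) ≠ 0 ∨ ((frame a j 1 0 : ℝ) : ℂ) ≠ 0 := by
  by_contra! h
  have hd := (frame a j).det_coe
  rw [Matrix.det_fin_two, Complex.ofReal_eq_zero.1 h.1, Complex.ofReal_eq_zero.1 h.2] at hd
  simp at hd

theorem mapGL_frame_smul_infty (a : ℕ → ℝ) (j : ℕ) :
    Matrix.SpecialLinearGroup.mapGL ℂ (frame a j) • (OnePoint.infty : Sphere) =
      homog (frame a j 0 0 : ℝ) (frame a j 1 0 : ℝ) := by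
  rw [← homog_zero (z := 1), smul_homog _ (by simp), mapGL_apply, mapGL_apply]
  simp

/-- Around an un-branched flower, the frame vectors turn counterclockwise by a half turn. -/
theorem wedge_pos_of_wraps {n : ℕ} {C : SCircle} {c : ZMod n → SCircle} (hw : Wraps C c 1)
    {mf : ZMod n → GL (Fin 2) ℂ} {a : ℕ → ℝ}
    (hmf : ∀ j, lineW.map (mf j) = C ∧ horoV.map (mf j) = c j)
    (hF : ∀ j : ℕ, ∃ k : ℂ, k ≠ 0 ∧ (mf (j : ZMod n) : Matrix (Fin 2) (Fin 2) ℂ) =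
        k • ((mf 0 * Matrix.SpecialLinearGroup.mapGL ℂ (frame a j) : GL (Fin 2) ℂ) :
          Matrix (Fin 2) (Fin 2) ℂ)) {i j : ℕ} (hij : i < j) (hjn : j ≤ n)
    (hne : 0 < i ∨ j < n) : 0 < wedge a i j := by
  obtain ⟨m, θ, hm, hθ, hstep, htot⟩ := hw
  have hmono : ∀ d i, i + d + 1 ≤ n → θ i < θ (i + d + 1) := by
    intro d
    induction d with
    | zero => exact fun i hi => (hstep i (by omega)).1
    | succ d ih =>
      exact fun i hi => (ih i (by omega)).trans (hstep (i + d + 1) (by omega)).1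
  have hlt : ∀ i j, i < j → j ≤ n → θ i < θ j := by
    intro i j h h'
    obtain ⟨d, rfl⟩ := Nat.exists_eq_add_of_lt h
    exact hmono d i h'
  have hle : ∀ i j, i ≤ j → j ≤ n → θ i ≤ θ j := fun i j h h' =>
    h.eq_or_lt.elim (fun e => e ▸ le_rfl) fun e => (hlt i j e h').le
  -- Half-angle differences lie strictly between 0 and π; the excluded pair (0, n) would give
  -- exactly π.
  have hsin : ∀ i j, i < j → j ≤ n → (0 < i ∨ j < n) → 0 < Real.sin (θ j / 2 - θ i / 2) := by
    intro i j h h' h''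
    have h1 := hlt i j h h'
    apply Real.sin_pos_of_pos_of_lt_pi
    · linarith
    · have h2 := hle 0 i (by omega) (by omega)
      have h3 := hle j n h' le_rfl
      rcases h'' with h'' | h''
      · have := hlt 0 i h'' (by omega)
        push_cast at htot
        linarith
      · have := hlt j n h'' le_rfl
        push_cast at htot
        linarith
  -- `N` preserves the half plane and takes the vectors at the half angles to the frame vectors, up
  -- to complex factors `μ j`.
  set N := (mf 0)⁻¹ * m * cayley with hN
  have hNW : lineW.map N = lineW := by
    rw [hN, ← SCircle.map_map, lineW_map_cayley, ← SCircle.map_map, hm, ← (hmf 0).1,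
      SCircle.map_map_inv]
  obtain ⟨κ, hκ, hNκ⟩ := exists_pos_of_lineW_map hNW
  have hpt : ∀ j : ℕ, j ≤ n → ∃ μ : ℂ,
      N 0 0 * (Real.cos (θ j / 2) : ℝ) + N 0 1 * (Real.sin (θ j / 2) : ℝ) =
        μ * (frame a j 0 0 : ℝ) ∧
      N 1 0 * (Real.cos (θ j / 2) : ℝ) + N 1 1 * (Real.sin (θ j / 2) : ℝ) =
        μ * (frame a j 1 0 : ℝ) := by
    intro j hj
    refine exists_smul_of_homog_eq (mulVec_ne_zero N (cos_sin_ne_zero _)) (frame_ne_zero a j) ?_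
    rw [← smul_homog N (cos_sin_ne_zero _), hN, mul_smul, cayley_smul, ← mapGL_frame_smul_infty]
    have h1 := hθ j hj
    rw [← (hmf j).1, ← (hmf j).2, map_bdry_inter _ lineW_inter_horoV, Set.mem_singleton_iff] at h1
    obtain ⟨k, -, hk⟩ := hF j
    rw [mul_smul, h1, smul_eq_of_matrix_eq hk, mul_smul, inv_smul_smul]
  choose! μ hμ using hpt
  have hrel : ∀ i j, i ≤ n → j ≤ n → (starRingEnd ℂ) (μ i) * μ j * (wedge a i j : ℝ) =
      ((κ * Real.sin (θ j / 2 - θ i / 2) : ℝ) : ℂ) := by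
    intro i j hi hj
    have h := hNκ (Real.cos (θ i / 2)) (Real.sin (θ i / 2)) (Real.cos (θ j / 2)) (Real.sin (θ j / 2))
    rw [(hμ i hi).1, (hμ i hi).2, (hμ j hj).1, (hμ j hj).2] at h
    rw [Real.sin_sub, show Real.sin (θ j / 2) * Real.cos (θ i / 2) -
      Real.cos (θ j / 2) * Real.sin (θ i / 2) = Real.cos (θ i / 2) * Real.sin (θ j / 2) -
      Real.sin (θ i / 2) * Real.cos (θ j / 2) by ring, ← h]
    simp only [wedge, map_mul, Complex.conj_ofReal]
    push_cast
    ring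
  -- Consecutive wedges are 1, so consecutive factors have the same argument; chaining this, all `μ`
  -- do, and each wedge inherits the sign of the sine.
  have hone : ∀ i, i + 1 ≤ n → ∃ r : ℝ, 0 < r ∧ (starRingEnd ℂ) (μ i) * μ (i + 1) = r := by
    intro i hi
    refine ⟨κ * Real.sin (θ (i + 1) / 2 - θ i / 2), mul_pos hκ (hsin i (i + 1) (by omega) hi
      (by omega)), ?_⟩
    rw [← hrel i (i + 1) (by omega) hi, wedge_succ]
    simp
  have hall : ∀ d i, i + d + 1 ≤ n →
      ∃ r : ℝ, 0 < r ∧ (starRingEnd ℂ) (μ i) * μ (i + d + 1) = r := by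
    intro d
    induction d with
    | zero => exact hone
    | succ d ih =>
      intro i hi
      obtain ⟨r, hr, h1⟩ := ih i (by omega)
      obtain ⟨r', hr', h2⟩ := hone (i + d + 1) (by omega)
      have hne : μ (i + d + 1) ≠ 0 := by
        intro h
        rw [h, mul_zero] at h1
        exact hr.ne (by exact_mod_cast h1)
      have hq : 0 < Complex.normSq (μ (i + d + 1)) := Complex.normSq_pos.2 hne
      refine ⟨r * r' / Complex.normSq (μ (i + d + 1)), by positivity, ?_⟩
      have hq' : ((Complex.normSq (μ (i + d + 1)) : ℝ) : ℂ) ≠ 0 := by exact_mod_cast hq.ne'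
      push_cast
      rw [eq_div_iff hq', ← h1, ← h2, ← Complex.mul_conj, ← add_assoc]
      ring
  obtain ⟨d, rfl⟩ := Nat.exists_eq_add_of_lt hij
  obtain ⟨r, hr, h1⟩ := hall d i hjn
  have h2 := hrel i (i + d + 1) (by omega) hjn
  rw [h1] at h2
  have h3 : r * wedge a i (i + d + 1) = κ * Real.sin (θ (i + d + 1) / 2 - θ i / 2) := by
    exact_mod_cast h2
  have h4 := mul_pos hκ (hsin i (i + d + 1) hij hjn hne)
  rw [← h3] at h4
  exact pos_of_mul_pos_right h4 hr.le

theorem wedge_and_frame_of_label {n : ℕ} (hn : 3 < n) {s : ZMod n → ℝ}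
    (h : IsUnbranchedLabel n s) {a : ℕ → ℝ} (ha : ∀ j : ℕ, a j = √3 * (1 - s (j : ZMod n))) :
    frame a n = -1 ∧ ∀ i j, i < j → j ≤ n → (0 < i ∨ j < n) → 0 < wedge a i j := by
  obtain ⟨C, c, ⟨-, hw⟩, hs⟩ := h
  obtain ⟨mf, hmf, hF⟩ := exists_faceMaps hs ha
  have hpos : ∀ i j, i < j → j ≤ n → (0 < i ∨ j < n) → 0 < wedge a i j :=
    fun i j h1 h2 h3 => wedge_pos_of_wraps hw hmf hF h1 h2 h3
  refine ⟨?_, hpos⟩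
  obtain ⟨k, hk, h1⟩ := hF n
  rw [ZMod.natCast_self] at h1
  refine (frame_eq_one_or_neg_one hk h1).resolve_left fun h2 => ?_
  -- Closing up to +1 would make the wedge of 1 and n equal to that of 1 and 0, which is -1.
  have h3 := hpos 1 n (by omega) le_rfl (Or.inl one_pos)
  have h4 : wedge a 1 n = wedge a 1 0 := by unfold wedge; rw [h2]; rfl
  rw [h4, wedge_swap, wedge_succ a 0] at h3
  linarith

/-! ### From positive continuants to a flower. -/

theorem frame_congr {a b : ℕ → ℝ} {j : ℕ} (h : ∀ i < j, a i = b i) : frame a j = frame b j := by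
  induction j with
  | zero => rfl
  | succ j ih => rw [frame, frame, ih fun i hi => h i (by omega), h j (by omega)]

/-- Changing the coefficient at 0 shears all later frames at once and keeps their second rows: a
free parameter for the first coordinates alone. -/
theorem frame_update_zero (b : ℕ → ℝ) (t : ℝ) (j : ℕ) :
    frame (Function.update b 0 (b 0 + t)) (j + 1) = translation t * frame b (j + 1) := by
  induction j with
  | zero =>
    have h := stepMatrix_eq (-t) (b 0)
    rw [neg_neg, sub_neg_eq_add] at h
    simp [frame, h]
  | succ j ih => rw [frame, ih, frame.eq_2 b (j + 1), Function.update_of_ne (by omega), mul_assoc]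

/-- Positive continuants extend to a closed sequence of frames. -/
theorem exists_closed_frames {n : ℕ} (hn : 3 < n) {u : ℕ → ℝ}
    (hu : ∀ j ∈ Finset.Icc 2 (n - 2), 0 < cPoly j u) :
    ∃ a : ℕ → ℝ, (∀ j, a (j + n) = a j) ∧ (∀ j ∈ Finset.Icc 1 (n - 3), a j = √3 * u j) ∧
      frame a n = -1 ∧ ∀ j, 0 < j → j < n → 0 < frame a j 1 0 := by
  obtain ⟨m, rfl⟩ : ∃ m, n = m + 3 := ⟨n - 3, by omega⟩
  simp only [show m + 3 - 2 = m + 1 by omega, show m + 3 - 3 = m by omega, Finset.mem_Icc] at hu ⊢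
  have hd : 0 < cPoly (m + 1) u := hu (m + 1) (by omega)
  -- The entries at n - 2 and n - 1 are solved from the recursion so that the continuants at n - 1
  -- and n become 1 and 0.
  set x : ℕ → ℝ := fun j => if j = m + 1 then (1 + cPoly m u) / cPoly (m + 1) u / √3 else
    if j = m + 2 then cPoly (m + 1) u / √3 else u j with hx
  set b₀ : ℕ → ℝ := fun j => √3 * x j with hb₀
  -- This shear moves the vector of index n - 1 to (0, 1); the determinant then yields the remaining
  -- entry of the last frame.
  set t : ℝ := -frame b₀ (m + 2) 0 0 with ht
  set b : ℕ → ℝ := Function.update b₀ 0 (b₀ 0 + t) with hb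
  have h3 := sqrt_three_pos.ne'
  have hy0 : ∀ j, frame b₀ j 1 0 = cPoly j x := fun j => by
    rw [← wedge_zero_left, ← Nat.zero_add j, ← cPoly_eq_wedge x b₀ (fun _ => rfl) 0 j, Nat.zero_add]
    rfl
  have hle : ∀ j, j ≤ m + 1 → cPoly j x = cPoly j u := fun j hj =>
    cPoly_congr j fun k hk hkj => by
      simp only [hx]
      rw [if_neg (by omega), if_neg (by omega)]
  have h2 : cPoly (m + 2) x = 1 := by
    rw [cPoly, hle _ le_rfl, hle _ (by omega)]
    simp only [hx, if_true]
    field_simp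
    ring
  have h1 : cPoly (m + 3) x = 0 := by
    rw [cPoly, h2, hle _ le_rfl]
    simp only [hx, if_true]
    rw [if_neg (by omega)]
    field_simp
    ring
  have hcol : ∀ j, frame b (j + 1) 1 0 = cPoly (j + 1) x ∧
      frame b (j + 1) 0 0 = frame b₀ (j + 1) 0 0 + t * cPoly (j + 1) x := fun j => by
    rw [hb, frame_update_zero, ← hy0]
    simp only [Matrix.SpecialLinearGroup.coe_mul, Matrix.mul_apply, Fin.sum_univ_two]
    simp [translation]
  have hbn : frame b (m + 3) = -1 := by
    have e10 : frame b (m + 3) 1 0 = 0 := by rw [(hcol (m + 2)).1, h1]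
    have e01 : frame b (m + 3) 0 1 = 0 := by
      rw [frame_succ_one, (hcol (m + 1)).2, h2, ht]
      ring
    have e11 : frame b (m + 3) 1 1 = -1 := by rw [frame_succ_one, (hcol (m + 1)).1, h2]
    have hdet := (frame b (m + 3)).det_coe
    rw [Matrix.det_fin_two, e10, e01, e11] at hdet
    ext i j
    fin_cases i <;> fin_cases j <;> simp [e10, e01, e11]
    linarith
  refine ⟨fun j => b (j % (m + 3)), fun j => by simp, fun j hj => ?_, ?_, fun j hj hjn => ?_⟩
  · simp only [Nat.mod_eq_of_lt (show j < m + 3 by omega), hb, hb₀, hx]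
    rw [Function.update_of_ne (by omega), if_neg (by omega), if_neg (by omega)]
  · rw [← hbn]
    exact frame_congr fun i hi => by simp only [Nat.mod_eq_of_lt hi]
  · rw [frame_congr (b := b) fun i hi => by simp only [Nat.mod_eq_of_lt (hi.trans hjn)]]
    obtain ⟨i, rfl⟩ : ∃ i, j = i + 1 := ⟨j - 1, by omega⟩
    rw [(hcol i).1]
    rcases Nat.eq_zero_or_pos i with rfl | hi
    · simp [cPoly]
    · rcases (show i + 1 ≤ m + 1 ∨ i = m + 1 by omega) with h | rfl
      · rw [hle _ h]
        exact hu _ (by omega)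
      · rw [h2]
        exact one_pos

/-- The angular coordinate of the vector of the `j`-th frame in a sequence of `n` frames. -/
def frameAngle (a : ℕ → ℝ) (n j : ℕ) : ℝ :=
  -- The vectors at 0 and n are meant to be ±(1, 0), where the quotient below would be a division by
  -- zero with the wrong angle π.
  if j = 0 then 0 else if j = n then 2 * Real.pi else
    Real.pi - 2 * Real.arctan (frame a j 0 0 / frame a j 1 0)

theorem frameAngle_spec {a : ℕ → ℝ} {n : ℕ} (hF : frame a n = -1)
    (hpos : ∀ j, 0 < j → j < n → 0 < frame a j 1 0) {j : ℕ} (hj : j ≤ n) :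
    homog (Real.cos (frameAngle a n j / 2) : ℝ) (Real.sin (frameAngle a n j / 2) : ℝ) =
      homog (frame a j 0 0 : ℝ) (frame a j 1 0 : ℝ) := by
  rw [homog_eq_homog_iff (cos_sin_ne_zero _) (frame_ne_zero a j)]
  unfold frameAngle
  split_ifs with h0 h1
  · simp [h0, frame]
  · simp [h1, hF]
  · have hy := hpos j (by omega) (by omega)
    rw [show (Real.pi - 2 * Real.arctan (frame a j 0 0 / frame a j 1 0)) / 2 =
      Real.pi / 2 - Real.arctan (frame a j 0 0 / frame a j 1 0) by ring, Real.cos_pi_div_two_sub,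
      Real.sin_pi_div_two_sub, Real.sin_arctan, Real.cos_arctan]
    norm_cast
    field_simp

theorem frameAngle_lt {a : ℕ → ℝ} {n : ℕ} (hn : 1 < n)
    (hpos : ∀ j, 0 < j → j < n → 0 < frame a j 1 0) {j : ℕ} (hj : j < n) :
    frameAngle a n j < frameAngle a n (j + 1) ∧
      frameAngle a n (j + 1) < frameAngle a n j + 2 * Real.pi := by
  have hpi := Real.pi_pos
  unfold frameAngle
  have hb := fun j => Real.arctan_lt_pi_div_two (frame a j 0 0 / frame a j 1 0)
  have hb' := fun j => Real.neg_pi_div_two_lt_arctan (frame a j 0 0 / frame a j 1 0)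
  have b1 := hb j
  have b2 := hb (j + 1)
  have b3 := hb' j
  have b4 := hb' (j + 1)
  by_cases h0 : j = 0
  · rw [if_pos h0, if_neg (by omega), if_neg (by omega)]
    constructor <;> linarith
  · rw [if_neg h0, if_neg (by omega), if_neg (by omega)]
    by_cases h1 : j + 1 = n
    · rw [if_pos h1]
      constructor <;> linarith
    · rw [if_neg h1]
      have y1 := hpos j (by omega) hj
      have y2 := hpos (j + 1) (by omega) (by omega)
      -- Consecutive wedge 1 with positive second coordinates says that the tangency points p/q
      -- decrease.
      have h2 : frame a (j + 1) 0 0 / frame a (j + 1) 1 0 < frame a j 0 0 / frame a j 1 0 := by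
        rw [div_lt_div_iff₀ y2 y1]
        have := wedge_succ a j
        unfold wedge at this
        linarith
      have h3 := Real.arctan_strictMono h2
      constructor <;> linarith

theorem isUnbranchedLabel_of_frames {n : ℕ} (hn : 3 < n) {s : ZMod n → ℝ} {a : ℕ → ℝ}
    (ha : ∀ j : ℕ, a j = √3 * (1 - s (j : ZMod n))) (hF : frame a n = -1)
    (hpos : ∀ j, 0 < j → j < n → 0 < frame a j 1 0) : IsUnbranchedLabel n s := by
  have : NeZero n := ⟨by omega⟩
  set f : ℕ → GL (Fin 2) ℂ := fun j => Matrix.SpecialLinearGroup.mapGL ℂ (frame a j) with hf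
  -- The frames only close up to -1, which acts trivially on the sphere.
  have hper : Function.Periodic (fun j => horoV.map (f j)) n := fun j => by
    apply SCircle.map_eq_of_matrix_eq (k := -1)
    ext i i'
    rw [hf, Matrix.smul_apply, mapGL_apply, mapGL_apply,
      frame_add (fun j => by rw [ha, ha]; simp) hF]
    simp
  set c : ZMod n → SCircle := fun j => horoV.map (f j.val) with hc
  have hcf : ∀ j : ℕ, c (j : ZMod n) = horoV.map (f j) := fun j => by
    simp only [hc, ZMod.val_natCast]
    exact hper.map_mod_nat j
  have hW : ∀ g : Matrix.SpecialLinearGroup (Fin 2) ℝ,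
      lineW.map (Matrix.SpecialLinearGroup.mapGL ℂ g) = lineW := fun g =>
    (hasForm_lineW.line_map g).ext hasForm_lineW
  -- The second column of a frame is minus the preceding vector, and a horodisc does not see the
  -- sign.
  have hA : ∀ j, horoA.map (f (j + 1)) = horoV.map (f j) := fun j => by
    refine (hasForm_horoA.horo_map _).ext ?_
    have := hasForm_horoV.horo_map (frame a j)
    simp only [frame_succ_one, mul_zero, mul_one, zero_add, add_zero] at this ⊢
    rwa [horoForm_neg]
  have hcast : ∀ j : ZMod n, ∃ i : ℕ, j = ((i + 1 : ℕ) : ZMod n) := fun j =>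
    ⟨(j - 1).val, by simp⟩
  refine ⟨lineW, c, ⟨⟨fun j => ?_, fun j => ?_⟩, ?_⟩, fun j => ?_⟩
  · have := lineW_tangent_horoV.map (f j.val)
    rwa [hf, hW] at this
  · obtain ⟨i, rfl⟩ := hcast j
    have := horoA_tangent_horoV.map (f (i + 1 + 1))
    rw [show ((i + 1 : ℕ) : ZMod n) + 1 = ((i + 1 + 1 : ℕ) : ZMod n) by push_cast; ring, hcf, hcf]
    rwa [hA] at this
  · refine ⟨cayley⁻¹, frameAngle a n, ?_, fun j hj => ?_, fun j hj => ?_, ?_⟩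
    · rw [← lineW_map_cayley, SCircle.map_map_inv]
    · rw [← cayley_smul, inv_smul_smul, hcf, ← hW (frame a j), map_bdry_inter _ lineW_inter_horoV,
        mapGL_frame_smul_infty, Set.mem_singleton_iff, frameAngle_spec hF hpos hj]
    · exact frameAngle_lt (by omega) hpos hj
    · simp [frameAngle, show n ≠ 0 by omega]
  · obtain ⟨i, rfl⟩ := hcast j
    set r : ℝ := √3 * s ((i + 1 : ℕ) : ZMod n) with hr
    rw [show ((i + 1 : ℕ) : ZMod n) + 1 = ((i + 1 + 1 : ℕ) : ZMod n) by push_cast; ring,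
      show ((i + 1 : ℕ) : ZMod n) - 1 = (i : ZMod n) by push_cast; ring, hcf, hcf, hcf,
      hasSchwarzian_iff]
    -- The second face map is forced by the translation relation with the first; it takes (√3, 1) to
    -- the next vector because √3 - r is the coefficient at i + 1.
    refine ⟨f (i + 1), Matrix.SpecialLinearGroup.mapGL ℂ (frame a (i + 1) * translation (-r)),
      ⟨rfl, hW _, hA i⟩, ⟨?_, hW _, ?_⟩, 1, one_ne_zero, ?_⟩
    · refine (hasForm_horoV.horo_map _).ext ?_
      have := hasForm_horoV.horo_map (frame a (i + 1))
      simp only [Matrix.SpecialLinearGroup.coe_mul, Matrix.mul_apply, Fin.sum_univ_two]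
      simpa [translation] using this
    · refine (hasForm_horoB.horo_map _).ext ?_
      have := hasForm_horoV.horo_map (frame a (i + 1 + 1))
      have har : a (i + 1) = √3 - r := by rw [ha, hr]; ring
      simp only [frame_succ_zero a (i + 1), har, Matrix.SpecialLinearGroup.coe_mul,
        Matrix.mul_apply, Fin.sum_univ_two] at this ⊢
      convert this using 2 <;> simp [translation] <;> ring
    · have : translation (-r) * translation r = 1 := by
        simpa using translation_mul_neg (-r)
      rw [one_smul, ← map_mul, mul_assoc, this, mul_one]

end FlowerPacking

end

theorem theoremT (n : ℕ) (hn : 3 < n) (u : ℕ → ℝ) :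
    ((∃ s : ZMod n → ℝ, FlowerPacking.IsUnbranchedLabel n s ∧
        ∀ j ∈ Finset.Icc 1 (n - 3), 1 - s (j : ZMod n) = u j) ↔
      ∀ j ∈ Finset.Icc 2 (n - 2), 0 < FlowerPacking.cPoly j u) ∧
    ∀ s : ZMod n → ℝ, FlowerPacking.IsUnbranchedLabel n s →
      (∀ j ∈ Finset.Icc 1 (n - 3), 1 - s (j : ZMod n) = u j) →
      ∀ v : ℕ → ℝ, (∀ j : ℕ, v j = 1 - s (j : ZMod n)) →
        (FlowerPacking.cPoly (n - 2) u ≠ 0 ∧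
          v (n - 2) = FlowerPacking.uFun n u) ∧
        (FlowerPacking.cPoly (n - 2) (fun i => v (i + 1)) ≠ 0 ∧
          v (n - 1) = FlowerPacking.uFun n (fun i => v (i + 1))) ∧
        (FlowerPacking.cPoly (n - 2) (fun i => v (i + 2)) ≠ 0 ∧
          v 0 = FlowerPacking.uFun n (fun i => v (i + 2))) := by
  have hcongr : ∀ (s : ZMod n → ℝ) (v : ℕ → ℝ),
      (∀ j ∈ Finset.Icc 1 (n - 3), 1 - s (j : ZMod n) = u j) →
      (∀ j : ℕ, v j = 1 - s (j : ZMod n)) → ∀ j ≤ n - 2,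
      FlowerPacking.cPoly j u = FlowerPacking.cPoly j v := fun s v hs hv j hj =>
    FlowerPacking.cPoly_congr j fun k hk hkj => by
      rw [hv, hs k (Finset.mem_Icc.2 ⟨hk, by omega⟩)]
  refine ⟨⟨?_, fun hu => ?_⟩, fun s hs hsu v hv => ?_⟩
  · rintro ⟨s, hs, hsu⟩ j hj
    rw [Finset.mem_Icc] at hj
    obtain ⟨-, hpos⟩ := FlowerPacking.wedge_and_frame_of_label hn hs
      (a := fun j => √3 * (1 - s (j : ZMod n))) fun j => rfl
    rw [hcongr s (fun j => 1 - s (j : ZMod n)) hsu (fun j => rfl) j hj.2]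
    have h := FlowerPacking.cPoly_eq_wedge (fun j => 1 - s (j : ZMod n)) _ (fun j => rfl) 0 j
    simp only [add_zero, zero_add] at h
    rw [h]
    exact hpos 0 j (by omega) (by omega) (Or.inr (by omega))
  · obtain ⟨a, hper, hau, hF, hpos⟩ := FlowerPacking.exists_closed_frames hn hu
    have h3 := FlowerPacking.sqrt_three_pos.ne'
    have ha : ∀ j : ℕ, a j = √3 * (1 - (1 - a (j : ZMod n).val / √3)) := fun j => by
      rw [ZMod.val_natCast, Function.Periodic.map_mod_nat hper j]
      field_simp
      ring
    refine ⟨fun j => 1 - a j.val / √3,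
      FlowerPacking.isUnbranchedLabel_of_frames hn ha hF hpos, fun j hj => ?_⟩
    apply mul_left_cancel₀ h3
    rw [← hau j hj]
    exact (ha j).symm
  · set a : ℕ → ℝ := fun j => √3 * v j with ha
    obtain ⟨hF, hpos⟩ := FlowerPacking.wedge_and_frame_of_label hn hs (a := a)
      fun j => by rw [ha, ← hv]
    have hvper : ∀ j, v (j + n) = v j := fun j => by simp [hv]
    have hper : ∀ j, a (j + n) = a j := fun j => by simp only [ha, hvper]
    -- The three formulas are one formula started at 0, 1, 2: the solved index i + (n - 2) is n - 2,
    -- n - 1 and n, the last being 0 modulo n.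
    have key : ∀ i, i ≤ 2 → _ := fun i hi => FlowerPacking.eq_uFun_of_closed (v := v) (a := a)
      (fun j => rfl) hn hper hF (i := i)
      (hpos i (i + (n - 2)) (by omega) (by omega) (by omega)).ne'
    have k0 := key 0 (by omega)
    have k1 := key 1 (by omega)
    have k2 := key 2 le_rfl
    simp only [add_zero, zero_add] at k0
    refine ⟨?_, ?_, ?_⟩
    · rw [FlowerPacking.uFun, hcongr s v hsu hv (n - 2) le_rfl,
        hcongr s v hsu hv (n - 3) (by omega)]
      exact k0
    · rwa [show 1 + (n - 2) = n - 1 by omega] at k1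
    · rwa [show 2 + (n - 2) = 0 + n by omega, hvper] at k2
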